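/- All Hilbert spaces are finite-dimensional, of dimension at least $1$, with fixed orthonormal (product) bases; $d_X$ is the dimension of $\mathcal H_X$. For an operator $M$ on a tensor product containing the factor $\mathcal H_X$ put ${}_XM := \frac{\mathbb 1_X}{d_X}\otimes \operatorname{tr}_X M$. The link product of $F\in\mathcal B(\mathcal H_X\otimes\mathcal H_Y)$ and $L\in\mathcal B(\mathcal H_Y\otimes\mathcal H_Z)$ is $F\star L:=\operatorname{tr}_Y[(F\otimes\mathbb 1_Z)(\mathbb 1_X\otimes L^{\mathrm T_Y})]\in\mathcal B(\mathcal H_X\otimes\mathcal H_Z)$, where $\mathrm T_Y$ is the partial transpose on $Y$. A Choi matrix of a channel (CPTP map) from $P$ to $Q$ is a matrix $C\ge 0$ on $\mathcal H_P\otimes\mathcal H_Q$ with $\operatorname{tr}_QC=\mathbb 1_P$; it acts by $\mathcal C(\rho)=\operatorname{tr}_P[C(\rho^{\mathrm T}\otimes\mathbb 1_Q)]$. A bipartite channel $\mathcal N$ with inputs $A_I,B_I$ and outputs $A_O,B_O$ is non-signalling if, for all states $\rho,\xi$ on $A_I$ and $\eta,\zeta$ on $B_I$, $\operatorname{tr}_{A_O}\mathcal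 N(\rho\otimes\eta)=\operatorname{tr}_{A_O}\mathcal N(\xi\otimes\eta)$ and $\operatorname{tr}_{B_O}\mathcal N(\rho\otimes\eta)=\operatorname{tr}_{B_O}\mathcal N(\rho\otimes\zeta)$. Channels are identified with their Choi matrices. Fix spaces $X_I,X_I',X_O,X_O'$ for $X\in\{A,B\}$. Consider matrices $\Upsilon$ on the tensor product of these eight spaces. * $\Upsilon$ is a completely admissible adapter ($\Upsilon\in\Theta_{\mathtt{CA}}$) if $\Upsilon\ge0$ and, for all additional spaces $\bar A_I,\bar A_O,\bar B_I,\bar B_O$ and every non-signalling channel $\bar M$ with inputs $A_I'\bar A_I$ (Alice), $B_I'\bar B_I$ (Bob) and outputs $A_O'\bar A_O$ (Alice), $B_O'\bar B_O$ (Bob), the link product $\Upsilon\star\bar M$ over the spaces $A_I',A_O',B_I',B_O'$ is a non-signalling channel with inputs $A_I\bar A_I$ (Alice), $B_I\bar B_I$ (Bob) and outputs $A_O\bar A_O$ (Alice), $B_O\bar B_O$ (Bob). * $\Upsilon$ is a non-signalling adapter ($\Upsilon\in\Theta_{\mathtt{NS}}$) if $\Upsilon\ge0$, $\Upsilon=(L_A\otimes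 L_B)[\Upsilon]$ and $\operatorname{tr}\Upsilon=d_{A_I}d_{A_O'}d_{B_I}d_{B_O'}$, where $$L_X[\Upsilon]=\Upsilon-{}_{X_O}\Upsilon+{}_{X_OX_O'}\Upsilon-{}_{X_I'X_OX_O'}\Upsilon+{}_{X_IX_I'X_OX_O'}\Upsilon .$$ Then, for every choice of the spaces $A_I,A_I',A_O,A_O',B_I,B_I',B_O,B_O'$, $$\Theta_{\mathtt{CA}}=\Theta_{\mathtt{NS}} .$$ -/

import Mathlib

open scoped Kronecker ComplexOrder

/-! Operators on a finite-dimensional Hilbert space with a fixed orthonormal basis indexed by a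
finite non-empty type are complex square matrices over that type; tensor products of spaces
correspond to products of index types. -/

universe u

namespace NSAdapter



section Tensor

variable {I X Y Z S R : Type*}

/-- Partial trace over the first tensor factor. -/
def traceFst [Fintype S] (M : Matrix (S × R) (S × R) ℂ) : Matrix R R ℂ :=
  Matrix.of fun r r' => ∑ s, M (s, r) (s, r')

/-- Partial trace over the second tensor factor. -/
def traceSnd [Fintype R] (M : Matrix (S × R) (S × R) ℂ) : Matrix S S ℂ :=
  Matrix.of fun s s' => ∑ r, M (s, r) (s', r)

/-- Partial transpose of the first tensor factor. -/
def transposeFst (M : Matrix (S × R) (S × R) ℂ) : Matrix (S × R) (S × R) ℂ :=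
  Matrix.of fun p q => M (q.1, p.2) (p.1, q.2)

/-- The link product `F_{XY} ⋆ L_{YZ} = tr_Y [(F_{XY} ⊗ 1_Z) (1_X ⊗ L_{YZ}^{T_Y})]`. -/
def link [Fintype X] [Fintype Y] [Fintype Z] [DecidableEq X] [DecidableEq Z]
    (F : Matrix (X × Y) (X × Y) ℂ) (L : Matrix (Y × Z) (Y × Z) ℂ) :
    Matrix (X × Z) (X × Z) ℂ :=
  let lhs : Matrix ((X × Y) × Z) ((X × Y) × Z) ℂ := F ⊗ₖ (1 : Matrix Z Z ℂ)
  let rhs : Matrix ((X × Y) × Z) ((X × Y) × Z) ℂ :=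
    Matrix.reindex (Equiv.prodAssoc X Y Z).symm (Equiv.prodAssoc X Y Z).symm
      ((1 : Matrix X X ℂ) ⊗ₖ transposeFst L)
  let e : (X × Y) × Z ≃ Y × (X × Z) :=
    ((Equiv.prodComm X Y).prodCongr (Equiv.refl Z)).trans (Equiv.prodAssoc Y X Z)
  traceFst (Matrix.reindex e e (lhs * rhs))

/-- The operator `_S M = (1_S / d_S) ⊗ tr_S M`, where the equivalence `e` singles out the tensor
factor `S` inside the whole space. -/
noncomputable def replaceTrace [Fintype S] [DecidableEq S] (e : I ≃ S × R) (M : Matrix I I ℂ) :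
    Matrix I I ℂ :=
  Matrix.reindex e.symm e.symm
    (((Fintype.card S : ℂ)⁻¹ • (1 : Matrix S S ℂ)) ⊗ₖ traceFst (Matrix.reindex e e M))

/-- Density matrices. -/
def IsState [Fintype S] (ρ : Matrix S S ℂ) : Prop :=
  ρ.PosSemidef ∧ ρ.trace = 1

end Tensor

section Channels

variable {P Q V W : Type*}

/-- `C` is the Choi matrix, on input `⊗` output, of a CPTP map. -/
def IsChannel [Fintype V] [DecidableEq P] (C : Matrix (P × V) (P × V) ℂ) : Prop :=
  C.PosSemidef ∧ traceSnd C = 1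

/-- The map `ρ ↦ tr_{in} [C (ρᵀ ⊗ 1_{out})]` with Choi matrix `C`. -/
def applyChoi [Fintype P] [Fintype V] [DecidableEq V]
    (C : Matrix (P × V) (P × V) ℂ) (ρ : Matrix P P ℂ) : Matrix V V ℂ :=
  traceFst (C * (ρ.transpose ⊗ₖ (1 : Matrix V V ℂ)))

/-- `M` (on Alice's input `P` and output `V`, and Bob's input `Q` and output `W`) is the Choi
matrix of a bipartite channel `P ⊗ Q → V ⊗ W` which is non-signalling in both directions: the
reduced output state of one party does not depend on the input state of the other party. -/
def IsNonSignallingChannel [Fintype P] [Fintype Q] [Fintype V] [Fintype W]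
    [DecidableEq P] [DecidableEq Q] [DecidableEq V] [DecidableEq W]
    (M : Matrix ((P × V) × (Q × W)) ((P × V) × (Q × W)) ℂ) : Prop :=
  let C : Matrix ((P × Q) × (V × W)) ((P × Q) × (V × W)) ℂ :=
    Matrix.reindex (Equiv.prodProdProdComm P V Q W) (Equiv.prodProdProdComm P V Q W) M
  IsChannel C ∧
  (∀ (ρ ξ : Matrix P P ℂ) (η : Matrix Q Q ℂ), IsState ρ → IsState ξ → IsState η →
    traceFst (applyChoi C (ρ ⊗ₖ η)) = traceFst (applyChoi C (ξ ⊗ₖ η))) ∧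
  (∀ (ρ : Matrix P P ℂ) (η ζ : Matrix Q Q ℂ), IsState ρ → IsState η → IsState ζ →
    traceSnd (applyChoi C (ρ ⊗ₖ η)) = traceSnd (applyChoi C (ρ ⊗ₖ ζ)))

end Channels

/-- The index type of one party holding two input spaces `XI`, `YI` and two output spaces
`XO`, `YO`, ordered as `(XI ⊗ YI) ⊗ (XO ⊗ YO)`. -/
abbrev Party (XI YI XO YO : Type*) := (XI × YI) × (XO × YO)

/-- Reordering of the tensor factors of a bipartite operator, separating for both parties the
first input and output spaces from the second ones. -/
def splitLegs (a a' b b' c c' d d' : Type*) :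
    Party a a' b b' × Party c c' d d' ≃ ((a × b) × (c × d)) × ((a' × b') × (c' × d')) where
  toFun p := (((p.1.1.1, p.1.2.1), (p.2.1.1, p.2.2.1)), ((p.1.1.2, p.1.2.2), (p.2.1.2, p.2.2.2)))
  invFun q := (((q.1.1.1, q.2.1.1), (q.1.1.2, q.2.1.2)), ((q.1.2.1, q.2.2.1), (q.1.2.2, q.2.2.2)))
  left_inv _ := rfl
  right_inv _ := rfl

section Adapters

variable {AI AI' AO AO' BI BI' BO BO' : Type u}

/-- The action `Υ ⋆ M` of an adapter `Υ` on `A A' B B'` on an operator `M` on `A' Ā B' B̄`: the link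
product over the primed spaces, with result on `A Ā B B̄`. -/
def adapterAction
    [Fintype AI] [Fintype AI'] [Fintype AO] [Fintype AO']
    [Fintype BI] [Fintype BI'] [Fintype BO] [Fintype BO']
    [DecidableEq AI] [DecidableEq AO] [DecidableEq BI] [DecidableEq BO]
    {AIbar AObar BIbar BObar : Type*}
    [Fintype AIbar] [Fintype AObar] [Fintype BIbar] [Fintype BObar]
    [DecidableEq AIbar] [DecidableEq AObar] [DecidableEq BIbar] [DecidableEq BObar]
    (U : Matrix (Party AI AI' AO AO' × Party BI BI' BO BO')
      (Party AI AI' AO AO' × Party BI BI' BO BO') ℂ)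
    (M : Matrix (Party AI' AIbar AO' AObar × Party BI' BIbar BO' BObar)
      (Party AI' AIbar AO' AObar × Party BI' BIbar BO' BObar) ℂ) :
    Matrix (Party AI AIbar AO AObar × Party BI BIbar BO BObar)
      (Party AI AIbar AO AObar × Party BI BIbar BO BObar) ℂ :=
  let eU := splitLegs AI AI' AO AO' BI BI' BO BO'
  let eM := splitLegs AI' AIbar AO' AObar BI' BIbar BO' BObar
  let eN := splitLegs AI AIbar AO AObar BI BIbar BO BObar
  Matrix.reindex eN.symm eN.symm (link (Matrix.reindex eU eU U) (Matrix.reindex eM eM M))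

/-- The set of completely admissible adapters: positive semidefinite matrices that map every
non-signalling channel, extended by arbitrary additional (barred) spaces, to a non-signalling
channel. -/
def completelyAdmissibleAdapters (AI AI' AO AO' BI BI' BO BO' : Type u)
    [Fintype AI] [Fintype AI'] [Fintype AO] [Fintype AO']
    [Fintype BI] [Fintype BI'] [Fintype BO] [Fintype BO']
    [DecidableEq AI] [DecidableEq AI'] [DecidableEq AO] [DecidableEq AO']
    [DecidableEq BI] [DecidableEq BI'] [DecidableEq BO] [DecidableEq BO'] :
    Set (Matrix (Party AI AI' AO AO' × Party BI BI' BO BO')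
      (Party AI AI' AO AO' × Party BI BI' BO BO') ℂ) :=
  {U | U.PosSemidef ∧
    ∀ (AIbar AObar BIbar BObar : Type u)
      [Fintype AIbar] [Fintype AObar] [Fintype BIbar] [Fintype BObar]
      [DecidableEq AIbar] [DecidableEq AObar] [DecidableEq BIbar] [DecidableEq BObar]
      [Nonempty AIbar] [Nonempty AObar] [Nonempty BIbar] [Nonempty BObar]
      (M : Matrix (Party AI' AIbar AO' AObar × Party BI' BIbar BO' BObar)
        (Party AI' AIbar AO' AObar × Party BI' BIbar BO' BObar) ℂ),
      IsNonSignallingChannel M → IsNonSignallingChannel (adapterAction U M)}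

end Adapters

section Projectors

variable {I R XI XI' XO XO' : Type*}

/-- Singling out the leg `X_O` of party `X`, where `R` is the rest of the space. -/
def legO (XI XI' XO XO' R : Type*) : Party XI XI' XO XO' × R ≃ XO × ((XI × XI') × XO' × R) where
  toFun p := (p.1.2.1, (p.1.1, p.1.2.2, p.2))
  invFun q := ((q.2.1, (q.1, q.2.2.1)), q.2.2.2)
  left_inv _ := rfl
  right_inv _ := rfl

/-- Singling out the legs `X_O X_O'`. -/
def legOO' (XI XI' XO XO' R : Type*) :
    Party XI XI' XO XO' × R ≃ (XO × XO') × ((XI × XI') × R) where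
  toFun p := (p.1.2, (p.1.1, p.2))
  invFun q := ((q.2.1, q.1), q.2.2)
  left_inv _ := rfl
  right_inv _ := rfl

/-- Singling out the legs `X_I' X_O X_O'`. -/
def legI'OO' (XI XI' XO XO' R : Type*) :
    Party XI XI' XO XO' × R ≃ (XI' × (XO × XO')) × (XI × R) where
  toFun p := ((p.1.1.2, p.1.2), (p.1.1.1, p.2))
  invFun q := (((q.2.1, q.1.1), q.1.2), q.2.2)
  left_inv _ := rfl
  right_inv _ := rfl

/-- The operator
`L_X[Υ] = Υ - _{X_O}Υ + _{X_O X_O'}Υ - _{X_I' X_O X_O'}Υ + _{X_I X_I' X_O X_O'}Υ`,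
where the equivalence `g` singles out the legs of party `X`. -/
noncomputable def projL [Fintype XI] [Fintype XI'] [Fintype XO] [Fintype XO']
    [DecidableEq XI] [DecidableEq XI'] [DecidableEq XO] [DecidableEq XO']
    (g : I ≃ Party XI XI' XO XO' × R) (U : Matrix I I ℂ) : Matrix I I ℂ :=
  U - replaceTrace (g.trans (legO XI XI' XO XO' R)) U
    + replaceTrace (g.trans (legOO' XI XI' XO XO' R)) U
    - replaceTrace (g.trans (legI'OO' XI XI' XO XO' R)) U
    + replaceTrace g U

/-- The set of non-signalling adapters. As `L_A` and `L_B` act on different tensor factors,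
`L_A ⊗ L_B` is the composition of `L_A ⊗ id` and `id ⊗ L_B`. -/
def nonSignallingAdapters (AI AI' AO AO' BI BI' BO BO' : Type u)
    [Fintype AI] [Fintype AI'] [Fintype AO] [Fintype AO']
    [Fintype BI] [Fintype BI'] [Fintype BO] [Fintype BO']
    [DecidableEq AI] [DecidableEq AI'] [DecidableEq AO] [DecidableEq AO']
    [DecidableEq BI] [DecidableEq BI'] [DecidableEq BO] [DecidableEq BO'] :
    Set (Matrix (Party AI AI' AO AO' × Party BI BI' BO BO')
      (Party AI AI' AO AO' × Party BI BI' BO BO') ℂ) :=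
  {U | U.PosSemidef ∧
    U = projL (Equiv.refl (Party AI AI' AO AO' × Party BI BI' BO BO'))
      (projL (Equiv.prodComm (Party AI AI' AO AO') (Party BI BI' BO BO')) U) ∧
    U.trace = (Fintype.card AI : ℂ) * Fintype.card AO' * Fintype.card BI * Fintype.card BO'}

end Projectors

end NSAdapter

/-! Non-signalling channels are the positive semidefinite matrices of the right trace in the tensor
product of the two one-party spaces `channelSpace`, and non-signalling adapters are those in the
tensor product of two one-party spaces `combSpace`, since `L_A ⊗ L_B` projects onto the latter.

The link product preserves positivity and factorises on product operators, so non-signalling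
adapters are completely admissible because, party by party, `combSpace` maps `channelSpace` to
`channelSpace` and is multiplicative on traces up to a dimensional factor.

Conversely, testing an adapter with an identity channel on one party's side exposes the operator
blocks of the adapter on the other side, and a one-party operator mapping all channels with an
ancilla to `channelSpace` lies in `combSpace`. A matrix all of whose blocks lie in the two one-party
spaces lies in their tensor product. -/

namespace NSAdapter

open Matrix

section KroneckerSpan

variable {S R : Type*}

/-- The tensor product of two spaces of matrices, as a space of matrices on the tensor product. -/
def kroneckerSpan (p : Submodule ℂ (Matrix S S ℂ)) (q : Submodule ℂ (Matrix R R ℂ)) :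
    Submodule ℂ (Matrix (S × R) (S × R) ℂ) :=
  Submodule.map₂ kroneckerBilinear p q

theorem kronecker_mem_kroneckerSpan {p : Submodule ℂ (Matrix S S ℂ)}
    {q : Submodule ℂ (Matrix R R ℂ)} {A : Matrix S S ℂ} {B : Matrix R R ℂ} (hA : A ∈ p)
    (hB : B ∈ q) : A ⊗ₖ B ∈ kroneckerSpan p q :=
  Submodule.apply_mem_map₂ kroneckerBilinear hA hB

theorem kroneckerSpan_le {p : Submodule ℂ (Matrix S S ℂ)} {q : Submodule ℂ (Matrix R R ℂ)}
    {t : Submodule ℂ (Matrix (S × R) (S × R) ℂ)} :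
    kroneckerSpan p q ≤ t ↔ ∀ A ∈ p, ∀ B ∈ q, A ⊗ₖ B ∈ t :=
  Submodule.map₂_le

/-- The partial matrix element `⟨r| U |r'⟩` in the second tensor factor. -/
def fstBlock (r r' : R) : Matrix (S × R) (S × R) ℂ →ₗ[ℂ] Matrix S S ℂ where
  toFun U := Matrix.of fun s s' => U (s, r) (s', r')
  map_add' _ _ := rfl
  map_smul' _ _ := rfl

/-- The partial matrix element `⟨s| U |s'⟩` in the first tensor factor. -/
def sndBlock (s s' : S) : Matrix (S × R) (S × R) ℂ →ₗ[ℂ] Matrix R R ℂ where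
  toFun U := Matrix.of fun r r' => U (s, r) (s', r')
  map_add' _ _ := rfl
  map_smul' _ _ := rfl

@[simp]
theorem fstBlock_apply (r r' : R) (U : Matrix (S × R) (S × R) ℂ) (s s' : S) :
    fstBlock r r' U s s' = U (s, r) (s', r') :=
  rfl

@[simp]
theorem sndBlock_apply (s s' : S) (U : Matrix (S × R) (S × R) ℂ) (r r' : R) :
    sndBlock s s' U r r' = U (s, r) (s', r') :=
  rfl

theorem fstBlock_kronecker (r r' : R) (A : Matrix S S ℂ) (B : Matrix R R ℂ) :
    fstBlock r r' (A ⊗ₖ B) = B r r' • A := by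
  ext s s'
  exact mul_comm _ _

theorem sndBlock_kronecker (s s' : S) (A : Matrix S S ℂ) (B : Matrix R R ℂ) :
    sndBlock s s' (A ⊗ₖ B) = A s s' • B :=
  rfl

theorem sum_single_kronecker_sndBlock [Fintype S] [DecidableEq S]
    (U : Matrix (S × R) (S × R) ℂ) :
    ∑ s, ∑ s', single s s' (1 : ℂ) ⊗ₖ sndBlock s s' U = U := by
  ext ⟨s, r⟩ ⟨s', r'⟩
  simp [Matrix.sum_apply, single_apply, ite_and]

theorem kroneckerSpan_top [Finite S] :
    kroneckerSpan (⊤ : Submodule ℂ (Matrix S S ℂ)) (⊤ : Submodule ℂ (Matrix R R ℂ)) = ⊤ := by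
  classical
  have := Fintype.ofFinite S
  refine eq_top_iff.2 fun U _ => ?_
  rw [← sum_single_kronecker_sndBlock U]
  exact sum_mem fun s _ => sum_mem fun s' _ => kronecker_mem_kroneckerSpan trivial trivial

theorem kroneckerSpan_le_comap_fstBlock (p : Submodule ℂ (Matrix S S ℂ))
    (q : Submodule ℂ (Matrix R R ℂ)) (r r' : R) : kroneckerSpan p q ≤ p.comap (fstBlock r r') :=
  kroneckerSpan_le.2 fun A hA B _ => by
    simpa only [Submodule.mem_comap, fstBlock_kronecker] using p.smul_mem _ hA

theorem kroneckerSpan_le_comap_sndBlock (p : Submodule ℂ (Matrix S S ℂ))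
    (q : Submodule ℂ (Matrix R R ℂ)) (s s' : S) : kroneckerSpan p q ≤ q.comap (sndBlock s s') :=
  kroneckerSpan_le.2 fun A _ B hB => by
    simpa only [Submodule.mem_comap, sndBlock_kronecker] using q.smul_mem _ hB

theorem mem_kroneckerSpan_iff [Finite S] {p : Submodule ℂ (Matrix S S ℂ)}
    {q : Submodule ℂ (Matrix R R ℂ)} {U : Matrix (S × R) (S × R) ℂ} :
    U ∈ kroneckerSpan p q ↔
      (∀ r r', fstBlock r r' U ∈ p) ∧ ∀ s s', sndBlock s s' U ∈ q := by
  classical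
  have := Fintype.ofFinite S
  refine ⟨fun hU => ⟨fun r r' => kroneckerSpan_le_comap_fstBlock p q r r' hU,
    fun s s' => kroneckerSpan_le_comap_sndBlock p q s s' hU⟩, fun ⟨hp, hq⟩ => ?_⟩
  -- A projection `π` onto `p` fixes all blocks of `U`, hence `U` is unchanged by `π` on its first
  -- factor, which puts that factor into `p`.
  obtain ⟨π, hπ⟩ := p.subtype.exists_leftInverse_of_injective p.ker_subtype
  have hU : ∑ s, ∑ s', (π (single s s' (1 : ℂ))).1 ⊗ₖ sndBlock s s' U = U := by
    ext ⟨s, r⟩ ⟨s', r'⟩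
    have hfix : π (fstBlock r r' U) = ⟨fstBlock r r' U, hp r r'⟩ :=
      LinearMap.congr_fun hπ ⟨fstBlock r r' U, hp r r'⟩
    have hsum : fstBlock r r' U = ∑ i, ∑ j, U (i, r) (j, r') • single i j (1 : ℂ) := by
      conv_lhs => rw [matrix_eq_sum_single (fstBlock r r' U)]
      simp only [fstBlock_apply, smul_single, smul_eq_mul, mul_one]
    calc _ = (π (fstBlock r r' U)).1 s s' := by
          rw [hsum]
          simp only [map_sum, map_smul, Submodule.coe_sum, Submodule.coe_smul, Matrix.sum_apply,
            Matrix.smul_apply, smul_eq_mul, kronecker_apply, sndBlock_apply, mul_comm]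
      _ = U (s, r) (s', r') := by rw [hfix]; rfl
  rw [← hU]
  exact sum_mem fun s _ => sum_mem fun s' _ => kronecker_mem_kroneckerSpan (π _).2 (hq s s')

theorem linearMap_ext_kronecker [Finite S] {N : Type*} [AddCommMonoid N] [Module ℂ N]
    {f g : Matrix (S × R) (S × R) ℂ →ₗ[ℂ] N} (h : ∀ A B, f (A ⊗ₖ B) = g (A ⊗ₖ B)) : f = g :=
  LinearMap.ext fun U =>
    (kroneckerSpan_top.ge.trans (kroneckerSpan_le.2 fun A _ B _ => h A B) :
      ⊤ ≤ LinearMap.eqLocus f g) (Submodule.mem_top (x := U))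

theorem apply_mem_of_mem_kroneckerSpan {S' R' N : Type*} [AddCommMonoid N] [Module ℂ N]
    (f : Matrix (S × R) (S × R) ℂ →ₗ[ℂ] Matrix (S' × R') (S' × R') ℂ →ₗ[ℂ] N)
    {p : Submodule ℂ (Matrix S S ℂ)} {q : Submodule ℂ (Matrix R R ℂ)}
    {p' : Submodule ℂ (Matrix S' S' ℂ)} {q' : Submodule ℂ (Matrix R' R' ℂ)}
    {t : Submodule ℂ N}
    (h : ∀ A ∈ p, ∀ B ∈ q, ∀ A' ∈ p', ∀ B' ∈ q', f (A ⊗ₖ B) (A' ⊗ₖ B') ∈ t)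
    {U : Matrix (S × R) (S × R) ℂ} {M : Matrix (S' × R') (S' × R') ℂ}
    (hU : U ∈ kroneckerSpan p q) (hM : M ∈ kroneckerSpan p' q') : f U M ∈ t := by
  suffices hle : kroneckerSpan p q ≤ t.comap (f.flip M) from hle hU
  refine kroneckerSpan_le.2 fun A hA B hB => ?_
  suffices hle : kroneckerSpan p' q' ≤ t.comap (f (A ⊗ₖ B)) from hle hM
  exact kroneckerSpan_le.2 fun A' hA' B' hB' => h A hA B hB A' hA' B' hB'

end KroneckerSpan

section PosSemidefSpan

variable {n : Type*}

open scoped Matrix.Norms.L2Operator MatrixOrder in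
theorem mem_span_posSemidef_of_isHermitian [Finite n] [DecidableEq n]
    {p : Submodule ℂ (Matrix n n ℂ)} (hone : 1 ∈ p) {A : Matrix n n ℂ} (hA : A ∈ p)
    (hAh : A.IsHermitian) :
    A ∈ Submodule.span ℂ {B | B.PosSemidef ∧ B ∈ p} := by
  have := Fintype.ofFinite n
  have hscalar : algebraMap ℝ (Matrix n n ℂ) ‖A‖ = (‖A‖ : ℂ) • 1 := by
    rw [Algebra.algebraMap_eq_smul_one, Complex.coe_smul]
  have hmem : (‖A‖ : ℂ) • (1 : Matrix n n ℂ) ∈ p := p.smul_mem _ hone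
  have hshift : (‖A‖ : ℂ) • 1 + A ∈ {B | B.PosSemidef ∧ B ∈ p} := by
    refine ⟨nonneg_iff_posSemidef.1 ?_, p.add_mem hmem hA⟩
    rw [← hscalar, ← neg_le_iff_add_nonneg']
    exact IsSelfAdjoint.neg_algebraMap_norm_le_self (a := A) hAh
  have hnorm : (‖A‖ : ℂ) • 1 ∈ {B | B.PosSemidef ∧ B ∈ p} :=
    ⟨PosSemidef.one.smul (by simp), hmem⟩
  simpa using sub_mem (Submodule.subset_span hshift) (Submodule.subset_span hnorm)

theorem span_posSemidef_mem_eq [Finite n] [DecidableEq n] {p : Submodule ℂ (Matrix n n ℂ)}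
    (hone : 1 ∈ p) (hstar : ∀ A ∈ p, Aᴴ ∈ p) :
    Submodule.span ℂ {A | A.PosSemidef ∧ A ∈ p} = p := by
  refine le_antisymm (Submodule.span_le.2 fun A hA => hA.2) fun A hA => ?_
  have hre : (realPart A : Matrix n n ℂ) ∈ p := by
    rw [realPart_apply_coe]
    exact p.smul_of_tower_mem _ (p.add_mem hA (hstar A hA))
  have him : (imaginaryPart A : Matrix n n ℂ) ∈ p := by
    rw [imaginaryPart_apply_coe]
    exact p.smul_mem _ (p.smul_of_tower_mem _ (p.sub_mem hA (hstar A hA)))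
  rw [← realPart_add_I_smul_imaginaryPart A]
  exact add_mem (mem_span_posSemidef_of_isHermitian hone hre (realPart A).2)
    (Submodule.smul_mem _ _ (mem_span_posSemidef_of_isHermitian hone him (imaginaryPart A).2))

theorem span_isState [Fintype n] : Submodule.span ℂ {ρ : Matrix n n ℂ | IsState ρ} = ⊤ := by
  classical
  rw [eq_top_iff, ← span_posSemidef_mem_eq (p := ⊤) (n := n) trivial fun _ _ => trivial,
    Submodule.span_le]
  rintro A ⟨hA, -⟩
  rcases eq_or_ne A.trace 0 with htr | htr
  · rw [hA.trace_eq_zero_iff.1 htr]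
    exact zero_mem _
  · have hstate : IsState (A.trace⁻¹ • A) :=
      ⟨hA.smul (inv_nonneg.2 hA.trace_nonneg), by rw [trace_smul, smul_eq_mul, inv_mul_cancel₀ htr]⟩
    have hmem : A.trace • A.trace⁻¹ • A ∈ Submodule.span ℂ {ρ : Matrix n n ℂ | IsState ρ} :=
      Submodule.smul_mem _ _ (Submodule.subset_span hstate)
    rwa [smul_inv_smul₀ htr] at hmem

end PosSemidefSpan

section ChannelSpace

variable {S R P V : Type*}

/-- `traceSnd` as a linear map. -/
def traceSndₗ [Fintype R] : Matrix (S × R) (S × R) ℂ →ₗ[ℂ] Matrix S S ℂ where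
  toFun := traceSnd
  map_add' _ _ := by ext; exact Finset.sum_add_distrib
  map_smul' _ _ := by ext; exact (Finset.mul_sum _ _ _).symm

theorem trace_traceSnd [Fintype S] [Fintype R] (M : Matrix (S × R) (S × R) ℂ) :
    (traceSnd M).trace = M.trace :=
  (Fintype.sum_prod_type fun x => M x x).symm

theorem traceSnd_kronecker [Fintype R] (A : Matrix S S ℂ) (B : Matrix R R ℂ) :
    traceSnd (A ⊗ₖ B) = B.trace • A := by
  ext s s'
  simp only [traceSnd, of_apply, kronecker_apply, ← Finset.mul_sum, Matrix.smul_apply,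
    smul_eq_mul, trace, diag_apply, mul_comm]

theorem traceSnd_one [Fintype R] [DecidableEq S] [DecidableEq R] :
    traceSnd (1 : Matrix (S × R) (S × R) ℂ) = (Fintype.card R : ℂ) • 1 := by
  rw [← one_kronecker_one, traceSnd_kronecker, trace_one]

theorem traceSnd_conjTranspose [Fintype R] (M : Matrix (S × R) (S × R) ℂ) :
    traceSnd Mᴴ = (traceSnd M)ᴴ := by
  ext s s'
  exact (star_sum _ _).symm

/-- The matrices whose output trace is a multiple of the identity on the input: the linear span of
the Choi matrices of channels, see `span_isChannel`. -/
def channelSpace (P V : Type*) [Fintype V] [DecidableEq P] :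
    Submodule ℂ (Matrix (P × V) (P × V) ℂ) :=
  (Submodule.span ℂ {1}).comap traceSndₗ

variable [Fintype V] [DecidableEq P] {C : Matrix (P × V) (P × V) ℂ}

theorem mem_channelSpace : C ∈ channelSpace P V ↔ ∃ c : ℂ, c • 1 = traceSnd C :=
  Submodule.mem_span_singleton

theorem IsChannel.mem_channelSpace (hC : IsChannel C) : C ∈ channelSpace P V :=
  NSAdapter.mem_channelSpace.2 ⟨1, by rw [one_smul, hC.2]⟩

theorem one_mem_channelSpace [DecidableEq V] : 1 ∈ channelSpace P V :=
  mem_channelSpace.2 ⟨_, traceSnd_one.symm⟩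

theorem conjTranspose_mem_channelSpace (hC : C ∈ channelSpace P V) :
    Cᴴ ∈ channelSpace P V := by
  obtain ⟨c, hc⟩ := mem_channelSpace.1 hC
  refine mem_channelSpace.2 ⟨star c, ?_⟩
  rw [traceSnd_conjTranspose, ← hc, conjTranspose_smul, conjTranspose_one]

theorem trace_eq_of_smul_one_eq_traceSnd [Fintype P] {c : ℂ} (hc : c • 1 = traceSnd C) :
    C.trace = c * Fintype.card P := by
  rw [← trace_traceSnd, ← hc, trace_smul, trace_one, smul_eq_mul]

theorem isChannel_iff [Fintype P] [Nonempty P] :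
    IsChannel C ↔ C.PosSemidef ∧ C ∈ channelSpace P V ∧ C.trace = Fintype.card P := by
  refine ⟨fun hC => ⟨hC.1, hC.mem_channelSpace, ?_⟩, fun ⟨hpos, hmem, htr⟩ => ⟨hpos, ?_⟩⟩
  · rw [← trace_traceSnd, hC.2, trace_one]
  · obtain ⟨c, hc⟩ := mem_channelSpace.1 hmem
    rw [trace_eq_of_smul_one_eq_traceSnd hc,
      mul_eq_right₀ (Nat.cast_ne_zero.2 Fintype.card_ne_zero)] at htr
    rw [← hc, htr, one_smul]

theorem span_isChannel [Finite P] [Nonempty P] :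
    Submodule.span ℂ {C : Matrix (P × V) (P × V) ℂ | IsChannel C} = channelSpace P V := by
  classical
  have := Fintype.ofFinite P
  refine le_antisymm (Submodule.span_le.2 fun C hC => IsChannel.mem_channelSpace hC) ?_
  conv_lhs =>
    rw [← span_posSemidef_mem_eq one_mem_channelSpace fun _ => conjTranspose_mem_channelSpace]
  rw [Submodule.span_le]
  rintro C ⟨hpos, hmem⟩
  have hcard : (Fintype.card P : ℂ) ≠ 0 := Nat.cast_ne_zero.2 Fintype.card_ne_zero
  rcases eq_or_ne C.trace 0 with htr | htr
  · rw [hpos.trace_eq_zero_iff.1 htr]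
    exact zero_mem _
  · set c := C.trace / Fintype.card P with hc
    have hc0 : c ≠ 0 := div_ne_zero htr hcard
    have hchannel : IsChannel (c⁻¹ • C) := by
      refine isChannel_iff.2 ⟨hpos.smul ?_, Submodule.smul_mem _ _ hmem, ?_⟩
      · exact inv_nonneg.2 (div_nonneg hpos.trace_nonneg (Nat.cast_nonneg _))
      · rw [trace_smul, smul_eq_mul, hc, inv_div, div_mul_cancel₀ _ htr]
    have hspan : c • c⁻¹ • C ∈ Submodule.span ℂ {C : Matrix (P × V) (P × V) ℂ | IsChannel C} :=
      Submodule.smul_mem _ _ (Submodule.subset_span hchannel)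
    rwa [smul_inv_smul₀ hc0] at hspan

end ChannelSpace

section NonSignalling

variable {P Q V W : Type*} [Fintype V] [Fintype W]

theorem traceSnd_reindex_prodProdProdComm_kronecker (C : Matrix (P × V) (P × V) ℂ)
    (D : Matrix (Q × W) (Q × W) ℂ) :
    traceSnd (reindex (.prodProdProdComm P V Q W) (.prodProdProdComm P V Q W) (C ⊗ₖ D)) =
      traceSnd C ⊗ₖ traceSnd D := by
  ext x x'
  exact (Fintype.sum_prod_type _).trans
    (Fintype.sum_mul_sum (fun v => C (x.1, v) (x'.1, v)) fun w => D (x.2, w) (x'.2, w)).symm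

theorem reindex_mem_channelSpace [DecidableEq P] [DecidableEq Q]
    {M : Matrix ((P × V) × (Q × W)) ((P × V) × (Q × W)) ℂ}
    (hM : M ∈ kroneckerSpan (channelSpace P V) (channelSpace Q W)) :
    reindex (.prodProdProdComm P V Q W) (.prodProdProdComm P V Q W) M ∈
      channelSpace (P × Q) (V × W) := by
  suffices hle : kroneckerSpan (channelSpace P V) (channelSpace Q W) ≤
      (channelSpace (P × Q) (V × W)).comap (reindexLinearEquiv ℂ ℂ (.prodProdProdComm P V Q W)
        (.prodProdProdComm P V Q W)).toLinearMap from hle hM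
  refine kroneckerSpan_le.2 fun C hC D hD => ?_
  obtain ⟨c, hc⟩ := mem_channelSpace.1 hC
  obtain ⟨d, hd⟩ := mem_channelSpace.1 hD
  refine mem_channelSpace.2 ⟨c * d, ?_⟩
  refine .trans ?_ (traceSnd_reindex_prodProdProdComm_kronecker C D).symm
  rw [← hc, ← hd, smul_kronecker, kronecker_smul, one_kronecker_one, smul_smul]

variable [Fintype P] [Fintype Q]

theorem eq_of_forall_isState {A B : Matrix P P ℂ}
    (h : ∀ ρ, IsState ρ → (A * ρᵀ).trace = (B * ρᵀ).trace) : A = B := by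
  have heq (ρ : Matrix P P ℂ) : (A * ρᵀ).trace = (B * ρᵀ).trace := by
    have hρ : ρ ∈ Submodule.span ℂ {ρ : Matrix P P ℂ | IsState ρ} := by
      rw [span_isState]
      trivial
    induction hρ using Submodule.span_induction with
    | mem ρ hρ => exact h ρ hρ
    | zero => simp only [transpose_zero, Matrix.mul_zero]
    | add ρ ξ _ _ hρ hξ => simp only [transpose_add, Matrix.mul_add, trace_add, hρ, hξ]
    | smul c ρ _ hρ => simp only [transpose_smul, Matrix.mul_smul, trace_smul, hρ]
  exact ext_iff_trace_mul_right.2 fun X => by simpa only [transpose_transpose] using heq Xᵀ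

theorem forall_isState_trace_eq_iff [DecidableEq P] {A : Matrix P P ℂ} :
    (∀ ρ ξ, IsState ρ → IsState ξ → (A * ρᵀ).trace = (A * ξᵀ).trace) ↔
      A ∈ Submodule.span ℂ {1} := by
  have htrace (c : ℂ) {ρ : Matrix P P ℂ} (hρ : IsState ρ) : ((c • 1) * ρᵀ).trace = c := by
    rw [smul_mul, Matrix.one_mul, trace_smul, trace_transpose, hρ.2, smul_eq_mul, mul_one]
  rw [Submodule.mem_span_singleton]
  constructor
  · intro h
    by_cases hstate : ∃ ξ : Matrix P P ℂ, IsState ξ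
    · obtain ⟨ξ, hξ⟩ := hstate
      exact ⟨(A * ξᵀ).trace, eq_of_forall_isState fun ρ hρ => by rw [htrace _ hρ, h ρ ξ hρ hξ]⟩
    · exact ⟨0, eq_of_forall_isState fun ρ hρ => (hstate ⟨ρ, hρ⟩).elim⟩
  · rintro ⟨c, rfl⟩ ρ ξ hρ hξ
    rw [htrace c hρ, htrace c hξ]

theorem applyChoi_apply [DecidableEq V] (C : Matrix (P × V) (P × V) ℂ) (ρ : Matrix P P ℂ)
    (v v' : V) : applyChoi C ρ v v' = (fstBlock v v' C * ρᵀ).trace := by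
  simp [applyChoi, traceFst, Matrix.mul_apply, Fintype.sum_prod_type, trace, one_apply]

theorem forall_isState_applyChoi_eq_iff [DecidableEq V] {C D : Matrix (P × V) (P × V) ℂ} :
    (∀ ρ, IsState ρ → applyChoi C ρ = applyChoi D ρ) ↔ C = D := by
  refine ⟨fun h => ?_, fun h _ _ => h ▸ rfl⟩
  ext ⟨p, v⟩ ⟨p', v'⟩
  have hblock : fstBlock v v' C = fstBlock v v' D := eq_of_forall_isState fun ρ hρ => by
    rw [← applyChoi_apply, ← applyChoi_apply, h ρ hρ]
  exact congr_fun₂ hblock p p'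

variable [DecidableEq V] [DecidableEq W]
  (M : Matrix ((P × V) × (Q × W)) ((P × V) × (Q × W)) ℂ) (ρ : Matrix P P ℂ) (η : Matrix Q Q ℂ)

theorem traceFst_applyChoi_kronecker :
    traceFst (applyChoi (reindex (.prodProdProdComm P V Q W) (.prodProdProdComm P V Q W) M)
      (ρ ⊗ₖ η)) =
      applyChoi (of fun r r' => (traceSnd (fstBlock r r' M) * ρᵀ).trace) η := by
  ext w w'
  simp only [traceFst, traceSnd, applyChoi_apply, trace, diag_apply, Matrix.mul_apply, of_apply,
    fstBlock_apply, transpose_apply, kronecker_apply, reindex_apply, submatrix_apply,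
    Equiv.prodProdProdComm_symm, Equiv.prodProdProdComm_apply, Fintype.sum_prod_type,
    Finset.sum_mul]
  simp only [← Fintype.sum_prod_type']
  let e : V × P × Q × P × Q ≃ Q × Q × P × P × V :=
    { toFun := fun ⟨v, p, q, p', q'⟩ => (q, q', p, p', v)
      invFun := fun ⟨q, q', p, p', v⟩ => (v, p, q, p', q')
      left_inv := fun _ => rfl
      right_inv := fun _ => rfl }
  exact Fintype.sum_equiv e _ _ fun _ => (mul_assoc _ _ _).symm

theorem traceSnd_applyChoi_kronecker :
    traceSnd (applyChoi (reindex (.prodProdProdComm P V Q W) (.prodProdProdComm P V Q W) M)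
      (ρ ⊗ₖ η)) =
      applyChoi (of fun s s' => (traceSnd (sndBlock s s' M) * ηᵀ).trace) ρ := by
  ext v v'
  simp only [traceSnd, applyChoi_apply, trace, diag_apply, Matrix.mul_apply, of_apply,
    fstBlock_apply, sndBlock_apply, transpose_apply, kronecker_apply, reindex_apply,
    submatrix_apply, Equiv.prodProdProdComm_symm, Equiv.prodProdProdComm_apply,
    Fintype.sum_prod_type, Finset.sum_mul]
  simp only [← Fintype.sum_prod_type']
  let e : W × P × Q × P × Q ≃ P × P × Q × Q × W :=
    { toFun := fun ⟨w, p, q, p', q'⟩ => (p, p', q, q', w)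
      invFun := fun ⟨p, p', q, q', w⟩ => (w, p, q, p', q')
      left_inv := fun _ => rfl
      right_inv := fun _ => rfl }
  exact Fintype.sum_equiv e _ _ fun _ => by rw [mul_comm (ρ _ _), mul_assoc]; rfl

variable {M}

theorem traceFst_applyChoi_independent_iff [DecidableEq P] :
    (∀ (ρ ξ : Matrix P P ℂ) (η : Matrix Q Q ℂ), IsState ρ → IsState ξ → IsState η →
      traceFst (applyChoi (reindex (.prodProdProdComm P V Q W) (.prodProdProdComm P V Q W) M)
        (ρ ⊗ₖ η)) =
      traceFst (applyChoi (reindex (.prodProdProdComm P V Q W) (.prodProdProdComm P V Q W) M)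
        (ξ ⊗ₖ η))) ↔
      ∀ r r', fstBlock r r' M ∈ channelSpace P V := by
  simp only [traceFst_applyChoi_kronecker]
  constructor
  · intro h r r'
    refine forall_isState_trace_eq_iff.1 fun ρ ξ hρ hξ => ?_
    have heq := forall_isState_applyChoi_eq_iff.1 fun η hη => h ρ ξ η hρ hξ hη
    exact congr_fun₂ heq r r'
  · intro h ρ ξ η hρ hξ _
    congr 1
    ext r r'
    exact forall_isState_trace_eq_iff.2 (h r r') ρ ξ hρ hξ

theorem traceSnd_applyChoi_independent_iff [DecidableEq Q] :
    (∀ (ρ : Matrix P P ℂ) (η ζ : Matrix Q Q ℂ), IsState ρ → IsState η → IsState ζ →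
      traceSnd (applyChoi (reindex (.prodProdProdComm P V Q W) (.prodProdProdComm P V Q W) M)
        (ρ ⊗ₖ η)) =
      traceSnd (applyChoi (reindex (.prodProdProdComm P V Q W) (.prodProdProdComm P V Q W) M)
        (ρ ⊗ₖ ζ))) ↔
      ∀ s s', sndBlock s s' M ∈ channelSpace Q W := by
  simp only [traceSnd_applyChoi_kronecker]
  constructor
  · intro h s s'
    refine forall_isState_trace_eq_iff.1 fun η ζ hη hζ => ?_
    have heq := forall_isState_applyChoi_eq_iff.1 fun ρ hρ => h ρ η ζ hρ hη hζ
    exact congr_fun₂ heq s s'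
  · intro h ρ η ζ _ hη hζ
    congr 1
    ext s s'
    exact forall_isState_trace_eq_iff.2 (h s s') η ζ hη hζ

variable [DecidableEq P] [DecidableEq Q]

theorem isNonSignallingChannel_iff [Nonempty P] [Nonempty Q] :
    IsNonSignallingChannel M ↔
      M.PosSemidef ∧ M ∈ kroneckerSpan (channelSpace P V) (channelSpace Q W) ∧
        M.trace = Fintype.card P * Fintype.card Q := by
  have htr : (reindex (.prodProdProdComm P V Q W) (.prodProdProdComm P V Q W) M).trace = M.trace :=
    Equiv.sum_comp _ fun x => M x x
  have hpos : (reindex (.prodProdProdComm P V Q W) (.prodProdProdComm P V Q W) M).PosSemidef ↔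
      M.PosSemidef := posSemidef_submatrix_equiv _
  have hspan : M ∈ kroneckerSpan (channelSpace P V) (channelSpace Q W) ↔ _ :=
    mem_kroneckerSpan_iff
  simp only [IsNonSignallingChannel, traceFst_applyChoi_independent_iff,
    traceSnd_applyChoi_independent_iff, ← hspan, isChannel_iff, hpos, htr, Fintype.card_prod,
    Nat.cast_mul]
  exact ⟨fun ⟨⟨hM, _, htr⟩, hspan⟩ => ⟨hM, hspan, htr⟩,
    fun ⟨hM, hspan, htr⟩ => ⟨⟨hM, reindex_mem_channelSpace hspan, htr⟩, hspan⟩⟩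

theorem IsChannel.isNonSignallingChannel_kronecker [Nonempty P] [Nonempty Q]
    {C : Matrix (P × V) (P × V) ℂ} {D : Matrix (Q × W) (Q × W) ℂ}
    (hC : IsChannel C) (hD : IsChannel D) : IsNonSignallingChannel (C ⊗ₖ D) := by
  obtain ⟨hCpos, hCmem, hCtr⟩ := isChannel_iff.1 hC
  obtain ⟨hDpos, hDmem, hDtr⟩ := isChannel_iff.1 hD
  refine isNonSignallingChannel_iff.2 ⟨hCpos.kronecker hDpos,
    kronecker_mem_kroneckerSpan hCmem hDmem, ?_⟩
  rw [trace_kronecker, hCtr, hDtr]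

end NonSignalling

section ChannelProjection

variable {P V : Type*} [Fintype P] [Fintype V] [DecidableEq P] [DecidableEq V]

/-- The projection `C ↦ C - _V C + _{PV} C` onto the space `channelSpace P V`. -/
noncomputable def channelProj (C : Matrix (P × V) (P × V) ℂ) : Matrix (P × V) (P × V) ℂ :=
  C - (Fintype.card V : ℂ)⁻¹ • (traceSnd C ⊗ₖ 1) +
    ((Fintype.card P : ℂ) * Fintype.card V)⁻¹ • (C.trace • 1)

variable [Nonempty V]

theorem channelProj_mem (C : Matrix (P × V) (P × V) ℂ) : channelProj C ∈ channelSpace P V := by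
  have hV : (Fintype.card V : ℂ) ≠ 0 := Nat.cast_ne_zero.2 Fintype.card_ne_zero
  suffices h : traceSndₗ (channelProj C) = ((Fintype.card P : ℂ)⁻¹ * C.trace) • 1 from
    mem_channelSpace.2 ⟨_, h.symm⟩
  rw [channelProj, map_add, map_sub, map_smul, map_smul, map_smul]
  change traceSnd C - _ • traceSnd _ + _ • _ • traceSnd _ = _
  rw [traceSnd_kronecker, traceSnd_one, trace_one, inv_smul_smul₀ hV, sub_self, zero_add, smul_smul,
    smul_smul]
  congr 1
  field

theorem channelProj_eq_self [Nonempty P] {C : Matrix (P × V) (P × V) ℂ}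
    (hC : C ∈ channelSpace P V) : channelProj C = C := by
  have hP : (Fintype.card P : ℂ) ≠ 0 := Nat.cast_ne_zero.2 Fintype.card_ne_zero
  obtain ⟨c, hc⟩ := mem_channelSpace.1 hC
  rw [channelProj, ← hc, trace_eq_of_smul_one_eq_traceSnd hc, smul_kronecker, one_kronecker_one,
    smul_smul, smul_smul, sub_add, sub_eq_self, ← sub_smul]
  convert zero_smul ℂ _
  field_simp
  ring

end ChannelProjection

section Comb

variable {XI XI' XO XO' : Type*} [Fintype XO]

/-- The partial trace over the first output leg `X_O` of a party. -/
def traceOut : Matrix (Party XI XI' XO XO') (Party XI XI' XO XO') ℂ →ₗ[ℂ]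
    Matrix ((XI × XI') × XO') ((XI × XI') × XO') ℂ where
  toFun Y := of fun x x' => ∑ o, Y (x.1, (o, x.2)) (x'.1, (o, x'.2))
  map_add' _ _ := by ext; exact Finset.sum_add_distrib
  map_smul' _ _ := by ext; exact (Finset.mul_sum _ _ _).symm

/-- The operator `1_{X_O} / d_{X_O} ⊗ T`, with the leg `X_O` in its place among those of the
party. -/
noncomputable def insertMixedOut [DecidableEq XO] :
    Matrix ((XI × XI') × XO') ((XI × XI') × XO') ℂ →ₗ[ℂ]
      Matrix (Party XI XI' XO XO') (Party XI XI' XO XO') ℂ where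
  toFun T := of fun x x' =>
    (Fintype.card XO : ℂ)⁻¹ * ((1 : Matrix XO XO ℂ) x.2.1 x'.2.1 *
      T (x.1, x.2.2) (x'.1, x'.2.2))
  map_add' _ _ := by ext; simp [mul_add]
  map_smul' _ _ := by ext; simp [mul_left_comm]

theorem traceOut_insertMixedOut [DecidableEq XO] [Nonempty XO]
    (T : Matrix ((XI × XI') × XO') ((XI × XI') × XO') ℂ) :
    traceOut (insertMixedOut (XO := XO) T) = T := by
  ext x x'
  simp [traceOut, insertMixedOut]

theorem trace_traceOut [Fintype XI] [Fintype XI'] [Fintype XO']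
    (Y : Matrix (Party XI XI' XO XO') (Party XI XI' XO XO') ℂ) :
    (traceOut Y).trace = Y.trace := by
  simp only [trace, traceOut, LinearMap.coe_mk, AddHom.coe_mk, diag_apply, of_apply,
    Fintype.sum_prod_type]
  exact Finset.sum_congr rfl fun _ _ => Finset.sum_congr rfl fun _ _ => Finset.sum_comm

/-- The one-party adapters with inputs `X_I`, `X_O'` and outputs `X_I'`, `X_O`, up to
normalization and positivity: tracing out `X_O` leaves the identity on `X_O'` tensored with an
element of the channel space from `X_I` to `X_I'`. -/
def combSpace (XI XI' XO XO' : Type*) [Fintype XI'] [Fintype XO] [DecidableEq XI]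
    [DecidableEq XO'] : Submodule ℂ (Matrix (Party XI XI' XO XO') (Party XI XI' XO XO') ℂ) :=
  ((channelSpace XI XI').map (kroneckerBilinear.flip (1 : Matrix XO' XO' ℂ))).comap traceOut

theorem mem_combSpace [Fintype XI'] [DecidableEq XI] [DecidableEq XO']
    {Y : Matrix (Party XI XI' XO XO') (Party XI XI' XO XO') ℂ} :
    Y ∈ combSpace XI XI' XO XO' ↔ ∃ K ∈ channelSpace XI XI', K ⊗ₖ 1 = traceOut Y :=
  Iff.rfl

variable [Fintype XI] [Fintype XI'] [Fintype XO']
  [DecidableEq XI] [DecidableEq XI'] [DecidableEq XO] [DecidableEq XO']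

/-- The one-party form of `projL`, see `projL_refl_kronecker`. The five terms are grouped so that it
subtracts from `Y` the part of `_{X_O}Y` which keeps `Y` out of `combSpace XI XI' XO XO'`. -/
noncomputable def combProj (Y : Matrix (Party XI XI' XO XO') (Party XI XI' XO XO') ℂ) :
    Matrix (Party XI XI' XO XO') (Party XI XI' XO XO') ℂ :=
  Y - insertMixedOut (traceOut Y -
    ((Fintype.card XO' : ℂ)⁻¹ • channelProj (traceSnd (traceOut Y))) ⊗ₖ 1)

theorem combProj_mem [Nonempty XI'] [Nonempty XO]
    (Y : Matrix (Party XI XI' XO XO') (Party XI XI' XO XO') ℂ) :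
    combProj Y ∈ combSpace XI XI' XO XO' := by
  refine mem_combSpace.2 ⟨_, Submodule.smul_mem _ (Fintype.card XO' : ℂ)⁻¹
    (channelProj_mem (traceSnd (traceOut Y))), ?_⟩
  rw [combProj, map_sub, traceOut_insertMixedOut, sub_sub_cancel]

theorem combProj_eq_self [Nonempty XI] [Nonempty XI'] [Nonempty XO']
    {Y : Matrix (Party XI XI' XO XO') (Party XI XI' XO XO') ℂ}
    (hY : Y ∈ combSpace XI XI' XO XO') : combProj Y = Y := by
  obtain ⟨K, hK, hKY⟩ := mem_combSpace.1 hY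
  have hO' : (Fintype.card XO' : ℂ) ≠ 0 := Nat.cast_ne_zero.2 Fintype.card_ne_zero
  rw [combProj, ← hKY, traceSnd_kronecker, trace_one,
    channelProj_eq_self (Submodule.smul_mem _ _ hK), inv_smul_smul₀ hO', sub_self, map_zero,
    sub_zero]

end Comb

section ProjL

variable {I S R XI XI' XO XO' : Type*}

theorem replaceTrace_apply [Fintype S] [DecidableEq S] (e : I ≃ S × R) (M : Matrix I I ℂ)
    (x x' : I) :
    replaceTrace e M x x' = (Fintype.card S : ℂ)⁻¹ * ((1 : Matrix S S ℂ) (e x).1 (e x').1 *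
      ∑ s, M (e.symm (s, (e x).2)) (e.symm (s, (e x').2))) :=
  mul_assoc _ _ _

theorem replaceTrace_add [Fintype S] [DecidableEq S] (e : I ≃ S × R) (M N : Matrix I I ℂ) :
    replaceTrace e (M + N) = replaceTrace e M + replaceTrace e N := by
  ext
  simp only [replaceTrace_apply, Matrix.add_apply, Finset.sum_add_distrib, mul_add]

theorem replaceTrace_smul [Fintype S] [DecidableEq S] (e : I ≃ S × R) (c : ℂ)
    (M : Matrix I I ℂ) : replaceTrace e (c • M) = c • replaceTrace e M := by
  ext
  simp only [replaceTrace_apply, Matrix.smul_apply, smul_eq_mul, ← Finset.mul_sum, mul_left_comm]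

theorem sub_kronecker (A B : Matrix S S ℂ) (C : Matrix R R ℂ) :
    (A - B) ⊗ₖ C = A ⊗ₖ C - B ⊗ₖ C :=
  LinearMap.map_sub₂ (kroneckerBilinear (R := ℂ)) A B C

section Kronecker

variable [Fintype XO] [DecidableEq XO] (Y : Matrix (Party XI XI' XO XO') (Party XI XI' XO XO') ℂ)
  (Z : Matrix R R ℂ)

theorem replaceTrace_legO_kronecker :
    replaceTrace (legO XI XI' XO XO' R) (Y ⊗ₖ Z) = insertMixedOut (traceOut Y) ⊗ₖ Z := by
  ext ⟨⟨i, o, o'⟩, r⟩ ⟨⟨j, p, p'⟩, s⟩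
  rw [replaceTrace_apply]
  change _ * ((1 : Matrix XO XO ℂ) o p * ∑ t, Y (i, (t, o')) (j, (t, p')) * Z r s) =
    _ * ((1 : Matrix XO XO ℂ) o p * ∑ t, Y (i, (t, o')) (j, (t, p'))) * Z r s
  rw [← Finset.sum_mul]
  ring

variable [Fintype XO'] [DecidableEq XO']

theorem replaceTrace_legOO'_kronecker :
    replaceTrace (legOO' XI XI' XO XO' R) (Y ⊗ₖ Z) =
      insertMixedOut (((Fintype.card XO' : ℂ)⁻¹ • traceSnd (traceOut Y)) ⊗ₖ 1) ⊗ₖ Z := by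
  ext ⟨⟨i, o⟩, r⟩ ⟨⟨j, p⟩, s⟩
  rw [replaceTrace_apply, Fintype.card_prod, Nat.cast_mul, ← one_kronecker_one,
    Fintype.sum_prod_type_right]
  change _ * ((1 : Matrix XO XO ℂ) o.1 p.1 * (1 : Matrix XO' XO' ℂ) o.2 p.2 *
      ∑ t', ∑ t, Y (i, (t, t')) (j, (t, t')) * Z r s) =
    _ * ((1 : Matrix XO XO ℂ) o.1 p.1 * ((Fintype.card XO' : ℂ)⁻¹ *
      (∑ t', ∑ t, Y (i, (t, t')) (j, (t, t'))) * (1 : Matrix XO' XO' ℂ) o.2 p.2)) * Z r s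
  simp only [← Finset.sum_mul]
  ring

variable [Fintype XI'] [DecidableEq XI']

theorem replaceTrace_legI'OO'_kronecker :
    replaceTrace (legI'OO' XI XI' XO XO' R) (Y ⊗ₖ Z) =
      insertMixedOut (((Fintype.card XO' : ℂ)⁻¹ • (Fintype.card XI' : ℂ)⁻¹ •
        traceSnd (traceSnd (traceOut Y)) ⊗ₖ (1 : Matrix XI' XI' ℂ)) ⊗ₖ 1) ⊗ₖ Z := by
  ext ⟨⟨i, o⟩, r⟩ ⟨⟨j, p⟩, s⟩
  rw [replaceTrace_apply, Fintype.card_prod, Fintype.card_prod, ← one_kronecker_one,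
    ← one_kronecker_one, Fintype.sum_prod_type]
  simp_rw [Fintype.sum_prod_type_right]
  push_cast
  change _ * (((1 : Matrix XI' XI' ℂ) i.2 j.2 *
      ((1 : Matrix XO XO ℂ) o.1 p.1 * (1 : Matrix XO' XO' ℂ) o.2 p.2)) *
      ∑ i', ∑ t', ∑ t, Y ((i.1, i'), (t, t')) ((j.1, i'), (t, t')) * Z r s) =
    _ * ((1 : Matrix XO XO ℂ) o.1 p.1 * ((Fintype.card XO' : ℂ)⁻¹ * ((Fintype.card XI' : ℂ)⁻¹ *
      ((∑ i', ∑ t', ∑ t, Y ((i.1, i'), (t, t')) ((j.1, i'), (t, t'))) *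
        (1 : Matrix XI' XI' ℂ) i.2 j.2)) * (1 : Matrix XO' XO' ℂ) o.2 p.2)) * Z r s
  simp only [← Finset.sum_mul]
  ring

variable [Fintype XI] [DecidableEq XI]

theorem replaceTrace_refl_kronecker :
    replaceTrace (Equiv.refl (Party XI XI' XO XO' × R)) (Y ⊗ₖ Z) =
      insertMixedOut (((Fintype.card XO' : ℂ)⁻¹ •
        ((Fintype.card XI : ℂ) * Fintype.card XI')⁻¹ • (traceSnd (traceOut Y)).trace •
          (1 : Matrix (XI × XI') (XI × XI') ℂ)) ⊗ₖ 1) ⊗ₖ Z := by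
  ext ⟨⟨i, o⟩, r⟩ ⟨⟨j, p⟩, s⟩
  rw [replaceTrace_apply, trace_traceSnd, trace_traceOut,
    ← one_kronecker_one (m := XI × XI'), ← one_kronecker_one (m := XO), Fintype.card_prod,
    Fintype.card_prod, Fintype.card_prod]
  push_cast
  have htrace : ∑ x, (Y ⊗ₖ Z) (x, r) (x, s) = Y.trace * Z r s := by
    rw [trace, Finset.sum_mul]
    rfl
  change _ * (((1 : Matrix (XI × XI') (XI × XI') ℂ) i j *
      ((1 : Matrix XO XO ℂ) o.1 p.1 * (1 : Matrix XO' XO' ℂ) o.2 p.2)) *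
      ∑ x, (Y ⊗ₖ Z) (x, r) (x, s)) =
    _ * ((1 : Matrix XO XO ℂ) o.1 p.1 * ((Fintype.card XO' : ℂ)⁻¹ * (_ * (Y.trace *
      (1 : Matrix (XI × XI') (XI × XI') ℂ) i j)) * (1 : Matrix XO' XO' ℂ) o.2 p.2)) * Z r s
  rw [htrace]
  ring

theorem projL_refl_kronecker :
    projL (Equiv.refl (Party XI XI' XO XO' × R)) (Y ⊗ₖ Z) = combProj Y ⊗ₖ Z := by
  simp only [projL, Equiv.refl_trans, replaceTrace_legO_kronecker, replaceTrace_legOO'_kronecker,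
    replaceTrace_legI'OO'_kronecker, replaceTrace_refl_kronecker, combProj, channelProj,
    smul_add, smul_sub, add_kronecker, sub_kronecker, map_sub, map_add]
  abel

theorem projL_prodComm_kronecker :
    projL (Equiv.prodComm R (Party XI XI' XO XO')) (Z ⊗ₖ Y) = Z ⊗ₖ combProj Y := by
  have hswap : reindex (Equiv.prodComm R _) (Equiv.prodComm R _) (Z ⊗ₖ Y) = Y ⊗ₖ Z := by
    ext
    exact mul_comm _ _
  have hprojL : projL (Equiv.prodComm R (Party XI XI' XO XO')) (Z ⊗ₖ Y) =
      reindex (Equiv.prodComm _ R) (Equiv.prodComm _ R)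
        (projL (Equiv.refl _) (reindex (Equiv.prodComm R _) (Equiv.prodComm R _) (Z ⊗ₖ Y))) := by
    ext
    rfl
  rw [hprojL, hswap, projL_refl_kronecker]
  ext
  exact mul_comm _ _

end Kronecker

variable [Fintype XI] [Fintype XI'] [Fintype XO] [Fintype XO']
  [DecidableEq XI] [DecidableEq XI'] [DecidableEq XO] [DecidableEq XO']

/-- `projL` as a linear map. -/
noncomputable def projLₗ (g : I ≃ Party XI XI' XO XO' × R) : Matrix I I ℂ →ₗ[ℂ] Matrix I I ℂ where
  toFun := projL g
  map_add' _ _ := by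
    simp only [projL, replaceTrace_add]
    abel
  map_smul' _ _ := by
    simp only [projL, replaceTrace_smul, smul_add, smul_sub, RingHom.id_apply]

end ProjL

section NonSignallingAdapters

variable {AI AI' AO AO' BI BI' BO BO' : Type u}
  [Fintype AI] [Fintype AI'] [Fintype AO] [Fintype AO']
  [Fintype BI] [Fintype BI'] [Fintype BO] [Fintype BO']
  [DecidableEq AI] [DecidableEq AI'] [DecidableEq AO] [DecidableEq AO']
  [DecidableEq BI] [DecidableEq BI'] [DecidableEq BO] [DecidableEq BO']
  [Nonempty AI] [Nonempty AI'] [Nonempty AO] [Nonempty AO']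
  [Nonempty BI] [Nonempty BI'] [Nonempty BO] [Nonempty BO']
  {U : Matrix (Party AI AI' AO AO' × Party BI BI' BO BO')
    (Party AI AI' AO AO' × Party BI BI' BO BO') ℂ}

theorem eq_projL_projL_iff :
    U = projL (Equiv.refl _) (projL (Equiv.prodComm _ _) U) ↔
      U ∈ kroneckerSpan (combSpace AI AI' AO AO') (combSpace BI BI' BO BO') := by
  set L := projLₗ (Equiv.refl (Party AI AI' AO AO' × Party BI BI' BO BO')) ∘ₗ
    projLₗ (Equiv.prodComm (Party AI AI' AO AO') (Party BI BI' BO BO'))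
  have hL (Y : Matrix (Party AI AI' AO AO') (Party AI AI' AO AO') ℂ)
      (Z : Matrix (Party BI BI' BO BO') (Party BI BI' BO BO') ℂ) :
      L (Y ⊗ₖ Z) = combProj Y ⊗ₖ combProj Z := by
    change projL _ (projL _ (Y ⊗ₖ Z)) = _
    rw [projL_prodComm_kronecker, projL_refl_kronecker]
  have hrange : kroneckerSpan ⊤ ⊤ ≤
      (kroneckerSpan (combSpace AI AI' AO AO') (combSpace BI BI' BO BO')).comap L :=
    kroneckerSpan_le.2 fun Y _ Z _ => by
      rw [Submodule.mem_comap, hL]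
      exact kronecker_mem_kroneckerSpan (combProj_mem Y) (combProj_mem Z)
  have hfix : kroneckerSpan (combSpace AI AI' AO AO') (combSpace BI BI' BO BO') ≤
      LinearMap.eqLocus .id L :=
    kroneckerSpan_le.2 fun Y hY Z hZ => by
      rw [LinearMap.mem_eqLocus, hL, combProj_eq_self hY, combProj_eq_self hZ, LinearMap.id_apply]
  refine ⟨fun hU => ?_, fun hU => hfix hU⟩
  rw [hU]
  exact hrange (kroneckerSpan_top.ge trivial)

theorem mem_nonSignallingAdapters_iff :
    U ∈ nonSignallingAdapters AI AI' AO AO' BI BI' BO BO' ↔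
      U.PosSemidef ∧ U ∈ kroneckerSpan (combSpace AI AI' AO AO') (combSpace BI BI' BO BO') ∧
        U.trace = (Fintype.card AI : ℂ) * Fintype.card AO' * Fintype.card BI *
          Fintype.card BO' :=
  and_congr_right' (and_congr_left' eq_projL_projL_iff)

end NonSignallingAdapters

section Link

variable {X Y Z : Type*} [Fintype X] [Fintype Y] [Fintype Z] [DecidableEq X] [DecidableEq Z]

theorem link_apply (F : Matrix (X × Y) (X × Y) ℂ) (L : Matrix (Y × Z) (Y × Z) ℂ) (x x' : X × Z) :
    link F L x x' = ∑ y, ∑ y', F (x.1, y) (x'.1, y') * L (y, x.2) (y', x'.2) := by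
  simp [link, traceFst, transposeFst, Matrix.mul_apply, Fintype.sum_prod_type, one_apply,
    Finset.sum_ite_irrel]

theorem link_one [DecidableEq Y] (F : Matrix (X × Y) (X × Y) ℂ) :
    link F (1 : Matrix (Y × Z) (Y × Z) ℂ) = traceSnd F ⊗ₖ 1 := by
  ext x x'
  simp only [link_apply, ← one_kronecker_one (m := Y), kronecker_apply, ← mul_assoc,
    ← Finset.sum_mul]
  congr 1
  simp only [one_apply, mul_ite, mul_one, mul_zero, Finset.sum_ite_eq, Finset.mem_univ, if_true,
    traceSnd, of_apply]

theorem posSemidef_link {F : Matrix (X × Y) (X × Y) ℂ} {L : Matrix (Y × Z) (Y × Z) ℂ}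
    (hF : F.PosSemidef) (hL : L.PosSemidef) : (link F L).PosSemidef := by
  classical
  let W : Matrix (X × Z) (Y × (X × Z)) ℂ := of fun x w => if x = w.2 then 1 else 0
  let f : Y × (X × Z) → (X × Y) × (Y × Z) := fun w => ((w.2.1, w.1), (w.1, w.2.2))
  have hlink : link F L = W * (F ⊗ₖ L).submatrix f f * Wᴴ := by
    ext x x'
    simp only [link_apply, Matrix.mul_apply, conjTranspose_apply, W, f, of_apply,
      Fintype.sum_prod_type_right (α₂ := X × Z), ite_mul, one_mul, zero_mul, submatrix_apply,
      kronecker_apply, apply_ite star, star_one, star_zero, mul_ite, mul_one, mul_zero,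
      Finset.sum_ite_eq, Finset.mem_univ, if_true, Finset.sum_ite_irrel, Finset.sum_const_zero]
    exact Finset.sum_comm
  rw [hlink]
  exact ((hF.kronecker hL).submatrix f).mul_mul_conjTranspose_same W

/-- The link product as a bilinear map. -/
def linkₗ : Matrix (X × Y) (X × Y) ℂ →ₗ[ℂ] Matrix (Y × Z) (Y × Z) ℂ →ₗ[ℂ]
    Matrix (X × Z) (X × Z) ℂ :=
  LinearMap.mk₂ ℂ link
    (fun _ _ _ => by
      ext
      simp only [link_apply, Matrix.add_apply, add_mul, Finset.sum_add_distrib])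
    (fun _ _ _ => by
      ext
      simp only [link_apply, Matrix.smul_apply, smul_eq_mul, mul_assoc, Finset.mul_sum])
    (fun _ _ _ => by
      ext
      simp only [link_apply, Matrix.add_apply, mul_add, Finset.sum_add_distrib])
    (fun _ _ _ => by
      ext
      simp only [link_apply, Matrix.smul_apply, smul_eq_mul, mul_left_comm, Finset.mul_sum])

end Link

section PartyAction

variable {XI XI' XO XO' XIbar XObar : Type*}
  [Fintype XI] [Fintype XI'] [Fintype XO] [Fintype XO'] [Fintype XIbar] [Fintype XObar]
  [DecidableEq XI] [DecidableEq XO] [DecidableEq XIbar] [DecidableEq XObar]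

/-- The one-party analogue of `adapterAction`: the link product over the primed legs of that party,
as a bilinear map. -/
def partyAction : Matrix (Party XI XI' XO XO') (Party XI XI' XO XO') ℂ →ₗ[ℂ]
    Matrix (Party XI' XIbar XO' XObar) (Party XI' XIbar XO' XObar) ℂ →ₗ[ℂ]
      Matrix (Party XI XIbar XO XObar) (Party XI XIbar XO XObar) ℂ :=
  (linkₗ.compl₁₂
    (reindexLinearEquiv ℂ ℂ (.prodProdProdComm XI XI' XO XO')
      (.prodProdProdComm XI XI' XO XO')).toLinearMap
    (reindexLinearEquiv ℂ ℂ (.prodProdProdComm XI' XIbar XO' XObar)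
      (.prodProdProdComm XI' XIbar XO' XObar)).toLinearMap).compr₂
    (reindexLinearEquiv ℂ ℂ (.prodProdProdComm XI XO XIbar XObar)
      (.prodProdProdComm XI XO XIbar XObar)).toLinearMap

variable (Y : Matrix (Party XI XI' XO XO') (Party XI XI' XO XO') ℂ)
  (C : Matrix (Party XI' XIbar XO' XObar) (Party XI' XIbar XO' XObar) ℂ)

theorem partyAction_apply (x x' : Party XI XIbar XO XObar) :
    partyAction Y C x x' = ∑ y : XI' × XO', ∑ y' : XI' × XO',
      Y ((x.1.1, y.1), (x.2.1, y.2)) ((x'.1.1, y'.1), (x'.2.1, y'.2)) *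
        C ((y.1, x.1.2), (y.2, x.2.2)) ((y'.1, x'.1.2), (y'.2, x'.2.2)) :=
  link_apply _ _ _ _

theorem traceSnd_partyAction_apply (x x' : XI × XIbar) :
    traceSnd (partyAction Y C) x x' = ∑ y : XI' × XO', ∑ y' : XI' × XO',
      traceOut Y ((x.1, y.1), y.2) ((x'.1, y'.1), y'.2) *
        ∑ v, C ((y.1, x.2), (y.2, v)) ((y'.1, x'.2), (y'.2, v)) := by
  simp only [traceSnd, of_apply, partyAction_apply, traceOut, LinearMap.coe_mk, AddHom.coe_mk,
    Finset.sum_mul_sum]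
  rw [Finset.sum_comm]
  refine Finset.sum_congr rfl fun y _ => ?_
  rw [Finset.sum_comm]
  exact Finset.sum_congr rfl fun y' _ => Fintype.sum_prod_type _

variable {Y}

theorem traceSnd_partyAction_eq_link [DecidableEq XO'] {K : Matrix (XI × XI') (XI × XI') ℂ}
    (hY : K ⊗ₖ 1 = traceOut Y) : traceSnd (partyAction Y C) = link K (traceSnd C) := by
  ext x x'
  rw [traceSnd_partyAction_apply]
  simp only [← hY, kronecker_apply, mul_assoc]
  simp only [Fintype.sum_prod_type (α₁ := XI'), one_apply, ite_mul, one_mul, zero_mul, mul_ite,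
    mul_zero, Finset.sum_ite_eq, Finset.mem_univ, if_true]
  simp only [link_apply, traceSnd, of_apply, Fintype.sum_prod_type (α₁ := XO'),
    Finset.mul_sum (s := (Finset.univ : Finset XO'))]
  exact Finset.sum_congr rfl fun _ _ => Finset.sum_comm

variable {C}

theorem partyAction_mem_channelSpace [DecidableEq XI'] [DecidableEq XO']
    (hY : Y ∈ combSpace XI XI' XO XO')
    (hC : C ∈ channelSpace (XI' × XIbar) (XO' × XObar)) :
    partyAction Y C ∈ channelSpace (XI × XIbar) (XO × XObar) := by
  obtain ⟨K, hK, hKY⟩ := mem_combSpace.1 hY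
  obtain ⟨k, hk⟩ := mem_channelSpace.1 hK
  obtain ⟨c, hc⟩ := mem_channelSpace.1 hC
  refine mem_channelSpace.2 ⟨c * k, ?_⟩
  have hlink : link K (c • 1) = c • link (Z := XIbar) K 1 := map_smul (linkₗ K) c 1
  rw [traceSnd_partyAction_eq_link C hKY, ← hc, hlink, link_one, ← hk, smul_kronecker,
    one_kronecker_one, smul_smul]

theorem trace_partyAction [DecidableEq XI'] [DecidableEq XO']
    (hY : Y ∈ combSpace XI XI' XO XO')
    (hC : C ∈ channelSpace (XI' × XIbar) (XO' × XObar)) :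
    (Fintype.card XI' : ℂ) * Fintype.card XO' * (partyAction Y C).trace = Y.trace * C.trace := by
  obtain ⟨K, -, hKY⟩ := mem_combSpace.1 hY
  obtain ⟨c, hc⟩ := mem_channelSpace.1 hC
  have hlink : link K (c • 1) = c • link (Z := XIbar) K 1 := map_smul (linkₗ K) c 1
  rw [← trace_traceSnd, traceSnd_partyAction_eq_link C hKY, ← hc, hlink, link_one, trace_smul,
    trace_kronecker, trace_traceSnd, trace_one, ← trace_traceOut Y, ← hKY, trace_kronecker,
    trace_one, trace_eq_of_smul_one_eq_traceSnd hc, Fintype.card_prod, smul_eq_mul]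
  push_cast
  ring

end PartyAction

section AdapterAction

variable {AI AI' AO AO' BI BI' BO BO' : Type u}
  [Fintype AI] [Fintype AI'] [Fintype AO] [Fintype AO']
  [Fintype BI] [Fintype BI'] [Fintype BO] [Fintype BO']
  [DecidableEq AI] [DecidableEq AO] [DecidableEq BI] [DecidableEq BO]
  {AIbar AObar BIbar BObar : Type*}
  [Fintype AIbar] [Fintype AObar] [Fintype BIbar] [Fintype BObar]
  [DecidableEq AIbar] [DecidableEq AObar] [DecidableEq BIbar] [DecidableEq BObar]

/-- `adapterAction` as a bilinear map. -/
def adapterActionₗ : Matrix (Party AI AI' AO AO' × Party BI BI' BO BO')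
      (Party AI AI' AO AO' × Party BI BI' BO BO') ℂ →ₗ[ℂ]
    Matrix (Party AI' AIbar AO' AObar × Party BI' BIbar BO' BObar)
      (Party AI' AIbar AO' AObar × Party BI' BIbar BO' BObar) ℂ →ₗ[ℂ]
    Matrix (Party AI AIbar AO AObar × Party BI BIbar BO BObar)
      (Party AI AIbar AO AObar × Party BI BIbar BO BObar) ℂ :=
  (linkₗ.compl₁₂
    (reindexLinearEquiv ℂ ℂ (splitLegs AI AI' AO AO' BI BI' BO BO')
      (splitLegs AI AI' AO AO' BI BI' BO BO')).toLinearMap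
    (reindexLinearEquiv ℂ ℂ (splitLegs AI' AIbar AO' AObar BI' BIbar BO' BObar)
      (splitLegs AI' AIbar AO' AObar BI' BIbar BO' BObar)).toLinearMap).compr₂
    (reindexLinearEquiv ℂ ℂ (splitLegs AI AIbar AO AObar BI BIbar BO BObar).symm
      (splitLegs AI AIbar AO AObar BI BIbar BO BObar).symm).toLinearMap

variable {U : Matrix (Party AI AI' AO AO' × Party BI BI' BO BO')
    (Party AI AI' AO AO' × Party BI BI' BO BO') ℂ}
  {M : Matrix (Party AI' AIbar AO' AObar × Party BI' BIbar BO' BObar)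
    (Party AI' AIbar AO' AObar × Party BI' BIbar BO' BObar) ℂ}

theorem adapterActionₗ_apply : adapterActionₗ U M = adapterAction U M :=
  rfl

theorem posSemidef_adapterAction (hU : U.PosSemidef) (hM : M.PosSemidef) :
    (adapterAction U M).PosSemidef :=
  (posSemidef_link (hU.submatrix (splitLegs AI AI' AO AO' BI BI' BO BO').symm)
    (hM.submatrix (splitLegs AI' AIbar AO' AObar BI' BIbar BO' BObar).symm)).submatrix
    (splitLegs AI AIbar AO AObar BI BIbar BO BObar)

theorem adapterAction_kronecker (Y : Matrix (Party AI AI' AO AO') (Party AI AI' AO AO') ℂ)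
    (Z : Matrix (Party BI BI' BO BO') (Party BI BI' BO BO') ℂ)
    (C : Matrix (Party AI' AIbar AO' AObar) (Party AI' AIbar AO' AObar) ℂ)
    (D : Matrix (Party BI' BIbar BO' BObar) (Party BI' BIbar BO' BObar) ℂ) :
    adapterAction (Y ⊗ₖ Z) (C ⊗ₖ D) = partyAction Y C ⊗ₖ partyAction Z D := by
  ext x x'
  have hsum (f g : (AI' × AO') → (AI' × AO') → ℂ) (f' g' : (BI' × BO') → (BI' × BO') → ℂ) :
      ∑ y : (AI' × AO') × (BI' × BO'), ∑ y' : (AI' × AO') × (BI' × BO'),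
        f y.1 y'.1 * f' y.2 y'.2 * (g y.1 y'.1 * g' y.2 y'.2) =
      (∑ y, ∑ y', f y y' * g y y') * ∑ y, ∑ y', f' y y' * g' y y' := by
    simp only [Finset.sum_mul_sum, Fintype.sum_prod_type (α₁ := AI' × AO'), mul_mul_mul_comm]
  rw [kronecker_apply, partyAction_apply, partyAction_apply, ← hsum]
  exact link_apply _ _ _ _

variable [DecidableEq AI'] [DecidableEq AO'] [DecidableEq BI'] [DecidableEq BO']

theorem adapterAction_mem_kroneckerSpan
    (hU : U ∈ kroneckerSpan (combSpace AI AI' AO AO') (combSpace BI BI' BO BO'))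
    (hM : M ∈ kroneckerSpan (channelSpace (AI' × AIbar) (AO' × AObar))
      (channelSpace (BI' × BIbar) (BO' × BObar))) :
    adapterAction U M ∈ kroneckerSpan (channelSpace (AI × AIbar) (AO × AObar))
      (channelSpace (BI × BIbar) (BO × BObar)) := by
  refine apply_mem_of_mem_kroneckerSpan adapterActionₗ (fun Y hY Z hZ C hC D hD => ?_) hU hM
  rw [adapterActionₗ_apply, adapterAction_kronecker]
  exact kronecker_mem_kroneckerSpan (partyAction_mem_channelSpace hY hC)
    (partyAction_mem_channelSpace hZ hD)

theorem trace_adapterAction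
    (hU : U ∈ kroneckerSpan (combSpace AI AI' AO AO') (combSpace BI BI' BO BO'))
    (hM : M ∈ kroneckerSpan (channelSpace (AI' × AIbar) (AO' × AObar))
      (channelSpace (BI' × BIbar) (BO' × BObar))) :
    (Fintype.card AI' : ℂ) * Fintype.card AO' * (Fintype.card BI' * Fintype.card BO') *
      (adapterAction U M).trace = U.trace * M.trace := by
  let f : Matrix (Party AI AI' AO AO' × Party BI BI' BO BO') _ ℂ →ₗ[ℂ]
      Matrix (Party AI' AIbar AO' AObar × Party BI' BIbar BO' BObar) _ ℂ →ₗ[ℂ] ℂ :=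
    ((Fintype.card AI' : ℂ) * Fintype.card AO' * (Fintype.card BI' * Fintype.card BO')) •
      adapterActionₗ.compr₂
        (traceLinearMap (Party AI AIbar AO AObar × Party BI BIbar BO BObar) ℂ ℂ) -
      (LinearMap.mul ℂ ℂ).compl₁₂ (traceLinearMap _ ℂ ℂ) (traceLinearMap _ ℂ ℂ)
  suffices h : f U M ∈ (⊥ : Submodule ℂ ℂ) from sub_eq_zero.1 ((Submodule.mem_bot ℂ).1 h)
  refine apply_mem_of_mem_kroneckerSpan f (fun Y hY Z hZ C hC D hD => ?_) hU hM
  refine (Submodule.mem_bot ℂ).2 (sub_eq_zero.2 ?_)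
  change _ * (adapterAction (Y ⊗ₖ Z) (C ⊗ₖ D)).trace = (Y ⊗ₖ Z).trace * (C ⊗ₖ D).trace
  rw [adapterAction_kronecker, trace_kronecker, trace_kronecker, trace_kronecker,
    mul_mul_mul_comm, trace_partyAction hY hC, trace_partyAction hZ hD, mul_mul_mul_comm]

end AdapterAction

section TestChannels

variable {XI XI' XO XO' A B : Type*}
  [Fintype XI] [Fintype XI'] [Fintype XO] [Fintype XO'] [Fintype A] [Fintype B]
  [DecidableEq XI] [DecidableEq XI'] [DecidableEq XO] [DecidableEq XO'] [DecidableEq A]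
  [DecidableEq B] {Y : Matrix (Party XI XI' XO XO') (Party XI XI' XO XO') ℂ}

theorem sndBlock_traceOut_mem_span_one [Nontrivial A] [Nonempty B]
    (hY : ∀ C ∈ channelSpace (XI' × A) (XO' × B), partyAction Y C ∈ channelSpace (XI × A) (XO × B))
    (x x' : XI × XI') : sndBlock x x' (traceOut Y) ∈ Submodule.span ℂ {1} := by
  obtain ⟨a, b, hab⟩ := exists_pair_ne A
  obtain ⟨v⟩ := ‹Nonempty B›
  refine forall_isState_trace_eq_iff.1 fun ρ ξ hρ hξ => sub_eq_zero.1 ?_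
  -- `C` has zero output trace, so it lies in `channelSpace`, while its ancilla part is
  -- off-diagonal: the corresponding entry of the output trace of its image is forced to vanish.
  let C : Matrix (Party XI' A XO' B) (Party XI' A XO' B) ℂ :=
    (single x.2 x'.2 1 ⊗ₖ single a b 1) ⊗ₖ ((ρ - ξ) ⊗ₖ single v v 1)
  have hC : C ∈ channelSpace (XI' × A) (XO' × B) :=
    mem_channelSpace.2 ⟨0, by
      rw [traceSnd_kronecker, trace_kronecker, trace_sub, hρ.2, hξ.2, sub_self, zero_mul, zero_smul,
        zero_smul]⟩
  obtain ⟨c, hc⟩ := mem_channelSpace.1 (hY C hC)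
  calc _ = traceSnd (partyAction Y C) (x.1, a) (x'.1, b) := by
        rw [← trace_sub, ← Matrix.mul_sub, ← transpose_sub, traceSnd_partyAction_apply]
        simp only [C, trace, diag_apply, Matrix.mul_apply, sndBlock_apply, transpose_apply,
          kronecker_apply, single_apply, Fintype.sum_prod_type, ite_and, ite_mul, mul_ite, one_mul,
          mul_one, zero_mul, mul_zero, Finset.sum_ite_eq, Finset.mem_univ, if_true,
          Finset.sum_ite_irrel, Finset.sum_const_zero]
    _ = 0 := by
        rw [← hc, Matrix.smul_apply, one_apply_ne (by simp [hab]), smul_zero]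

theorem mem_combSpace_of_forall_mem_channelSpace [Nontrivial A] [Nonempty B] [Nonempty XO']
    (hY : ∀ C ∈ channelSpace (XI' × A) (XO' × B),
      partyAction Y C ∈ channelSpace (XI × A) (XO × B)) : Y ∈ combSpace XI XI' XO XO' := by
  choose K hK using fun x x' =>
    Submodule.mem_span_singleton.1 (sndBlock_traceOut_mem_span_one hY x x')
  have hKY : of K ⊗ₖ 1 = traceOut Y := by
    ext ⟨x, o⟩ ⟨x', o'⟩
    exact congr_fun₂ (hK x x') o o'
  obtain ⟨k, hk⟩ := mem_channelSpace.1 (hY 1 one_mem_channelSpace)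
  have hcard : (Fintype.card (XO' × B) : ℂ) ≠ 0 := Nat.cast_ne_zero.2 Fintype.card_ne_zero
  have hlink : traceSnd (partyAction Y (1 : Matrix (Party XI' A XO' B) _ ℂ)) =
      (Fintype.card (XO' × B) : ℂ) • traceSnd (of K) ⊗ₖ 1 := by
    rw [traceSnd_partyAction_eq_link 1 hKY, traceSnd_one, ← link_one]
    exact map_smul (linkₗ (of K)) _ 1
  obtain ⟨a⟩ : Nonempty A := inferInstance
  have hblock := congr_arg (fstBlock a a) (hk.trans hlink)
  rw [← one_kronecker_one (m := XI), map_smul, map_smul, fstBlock_kronecker, fstBlock_kronecker,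
    one_apply_eq, one_smul, one_smul] at hblock
  exact mem_combSpace.2 ⟨of K, mem_channelSpace.2 ⟨(Fintype.card (XO' × B) : ℂ)⁻¹ * k, by
    rw [mul_smul, hblock, inv_smul_smul₀ hcard]⟩, hKY⟩

theorem mem_combSpace_of_forall_isChannel [Nontrivial A] [Nonempty B] [Nonempty XI']
    [Nonempty XO'] (hY : ∀ C : Matrix (Party XI' A XO' B) (Party XI' A XO' B) ℂ, IsChannel C →
      partyAction Y C ∈ channelSpace (XI × A) (XO × B)) : Y ∈ combSpace XI XI' XO XO' := by
  refine mem_combSpace_of_forall_mem_channelSpace (A := A) (B := B) fun C hC => ?_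
  rw [← span_isChannel] at hC
  exact (Submodule.span_le.2 hY : _ ≤ (channelSpace (XI × A) (XO × B)).comap (partyAction Y)) hC

end TestChannels

section CrossChannel

variable {XI XI' XO XO' : Type*}

/-- The exchange of the primed legs of a party, see `partyAction_crossChannel`. -/
def crossLegs (x : Party XI XI' XO XO') : Party XI XO' XO XI' :=
  ((x.1.1, x.2.2), (x.2.1, x.1.2))

/-- The Choi matrix of the identity channel from `X_I' X_O'` to itself, the output legs being
ordered as `X_O' X_I'` so that `X_O'` takes the place of the barred input leg and `X_I'` that of the
barred output leg. -/
def crossChannel (XI' XO' : Type*) [DecidableEq XI'] [DecidableEq XO'] :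
    Matrix (Party XI' XO' XO' XI') (Party XI' XO' XO' XI') ℂ :=
  let φ : Party XI' XO' XO' XI' → ℂ := fun x => if x.1 = x.2.swap then 1 else 0
  vecMulVec φ (star φ)

variable [Fintype XI'] [Fintype XO'] [DecidableEq XI'] [DecidableEq XO']

theorem isChannel_crossChannel : IsChannel (crossChannel XI' XO') := by
  refine ⟨posSemidef_vecMulVec_self_star _, ?_⟩
  ext ⟨i, o⟩ ⟨j, p⟩
  simp [crossChannel, traceSnd, one_apply, Fintype.sum_prod_type, vecMulVec_apply, ite_and]

theorem partyAction_crossChannel [Fintype XI] [Fintype XO] [DecidableEq XI] [DecidableEq XO]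
    (Y : Matrix (Party XI XI' XO XO') (Party XI XI' XO XO') ℂ) (x x' : Party XI XI' XO XO') :
    partyAction Y (crossChannel XI' XO') (crossLegs x) (crossLegs x') = Y x x' := by
  rw [partyAction_apply]
  simp [crossChannel, crossLegs, Fintype.sum_prod_type, vecMulVec_apply, ite_and,
    apply_ite (starRingEnd ℂ)]

end CrossChannel

section CompletelyAdmissibleAdapters

variable {AI AI' AO AO' BI BI' BO BO' : Type u}
  [Fintype AI] [Fintype AI'] [Fintype AO] [Fintype AO']
  [Fintype BI] [Fintype BI'] [Fintype BO] [Fintype BO']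
  [DecidableEq AI] [DecidableEq AO] [DecidableEq BI] [DecidableEq BO]

theorem fstBlock_adapterAction_kronecker_crossChannel {A B : Type*} [Fintype A] [Fintype B]
    [DecidableEq A] [DecidableEq B] [DecidableEq BI'] [DecidableEq BO']
    (U : Matrix (Party AI AI' AO AO' × Party BI BI' BO BO')
      (Party AI AI' AO AO' × Party BI BI' BO BO') ℂ)
    (C : Matrix (Party AI' A AO' B) (Party AI' A AO' B) ℂ) (r r' : Party BI BI' BO BO') :
    fstBlock (crossLegs r) (crossLegs r') (adapterAction U (C ⊗ₖ crossChannel BI' BO')) =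
      partyAction (fstBlock r r' U) C := by
  refine LinearMap.congr_fun (f := fstBlock (crossLegs r) (crossLegs r') ∘ₗ
    adapterActionₗ.flip (C ⊗ₖ crossChannel BI' BO')) (g := partyAction.flip C ∘ₗ fstBlock r r')
    (linearMap_ext_kronecker fun Y Z => ?_) U
  change fstBlock _ _ (adapterAction (Y ⊗ₖ Z) _) = partyAction (fstBlock _ _ (Y ⊗ₖ Z)) C
  rw [adapterAction_kronecker, fstBlock_kronecker, fstBlock_kronecker, partyAction_crossChannel,
    map_smul, LinearMap.smul_apply]

theorem sndBlock_adapterAction_crossChannel_kronecker {A B : Type*} [Fintype A] [Fintype B]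
    [DecidableEq A] [DecidableEq B] [DecidableEq AI'] [DecidableEq AO']
    (U : Matrix (Party AI AI' AO AO' × Party BI BI' BO BO')
      (Party AI AI' AO AO' × Party BI BI' BO BO') ℂ)
    (C : Matrix (Party BI' A BO' B) (Party BI' A BO' B) ℂ) (s s' : Party AI AI' AO AO') :
    sndBlock (crossLegs s) (crossLegs s') (adapterAction U (crossChannel AI' AO' ⊗ₖ C)) =
      partyAction (sndBlock s s' U) C := by
  refine LinearMap.congr_fun (f := sndBlock (crossLegs s) (crossLegs s') ∘ₗ
    adapterActionₗ.flip (crossChannel AI' AO' ⊗ₖ C)) (g := partyAction.flip C ∘ₗ sndBlock s s')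
    (linearMap_ext_kronecker fun Y Z => ?_) U
  change sndBlock _ _ (adapterAction (Y ⊗ₖ Z) _) = partyAction (sndBlock _ _ (Y ⊗ₖ Z)) C
  rw [adapterAction_kronecker, sndBlock_kronecker, sndBlock_kronecker, partyAction_crossChannel,
    map_smul, LinearMap.smul_apply]

variable [DecidableEq AI'] [DecidableEq AO'] [DecidableEq BI'] [DecidableEq BO']
  [Nonempty AI] [Nonempty AI'] [Nonempty AO'] [Nonempty BI] [Nonempty BI'] [Nonempty BO']
  {U : Matrix (Party AI AI' AO AO' × Party BI BI' BO BO')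
    (Party AI AI' AO AO' × Party BI BI' BO BO') ℂ}

theorem fstBlock_mem_combSpace
    (hU : U ∈ completelyAdmissibleAdapters AI AI' AO AO' BI BI' BO BO')
    (r r' : Party BI BI' BO BO') : fstBlock r r' U ∈ combSpace AI AI' AO AO' := by
  refine mem_combSpace_of_forall_isChannel (A := ULift.{u} Bool) (B := PUnit.{u + 1}) fun C hC => ?_
  have himage := hU.2 _ _ _ _ _ (hC.isNonSignallingChannel_kronecker
    (isChannel_crossChannel (XI' := BI') (XO' := BO')))
  rw [← fstBlock_adapterAction_kronecker_crossChannel]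
  exact (mem_kroneckerSpan_iff.1 (isNonSignallingChannel_iff.1 himage).2.1).1 _ _

theorem sndBlock_mem_combSpace
    (hU : U ∈ completelyAdmissibleAdapters AI AI' AO AO' BI BI' BO BO')
    (s s' : Party AI AI' AO AO') : sndBlock s s' U ∈ combSpace BI BI' BO BO' := by
  refine mem_combSpace_of_forall_isChannel (A := ULift.{u} Bool) (B := PUnit.{u + 1}) fun C hC => ?_
  have himage := hU.2 _ _ _ _ _
    ((isChannel_crossChannel (XI' := AI') (XO' := AO')).isNonSignallingChannel_kronecker hC)
  rw [← sndBlock_adapterAction_crossChannel_kronecker]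
  exact (mem_kroneckerSpan_iff.1 (isNonSignallingChannel_iff.1 himage).2.1).2 _ _

variable [Nonempty AO] [Nonempty BO]

theorem completelyAdmissibleAdapters_subset_nonSignallingAdapters :
    completelyAdmissibleAdapters AI AI' AO AO' BI BI' BO BO' ⊆
      nonSignallingAdapters AI AI' AO AO' BI BI' BO BO' := by
  intro U hU
  have hspan : U ∈ kroneckerSpan (combSpace AI AI' AO AO') (combSpace BI BI' BO BO') :=
    mem_kroneckerSpan_iff.2 ⟨fstBlock_mem_combSpace hU, sndBlock_mem_combSpace hU⟩
  refine mem_nonSignallingAdapters_iff.2 ⟨hU.1, hspan, ?_⟩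
  have hcross : IsNonSignallingChannel (crossChannel AI' AO' ⊗ₖ crossChannel BI' BO') :=
    isChannel_crossChannel.isNonSignallingChannel_kronecker isChannel_crossChannel
  obtain ⟨-, hcrossSpan, hcrossTr⟩ := isNonSignallingChannel_iff.1 hcross
  obtain ⟨-, -, himageTr⟩ := isNonSignallingChannel_iff.1 (hU.2 _ _ _ _ _ hcross)
  have htr := trace_adapterAction hspan hcrossSpan
  rw [hcrossTr, himageTr, mul_comm] at htr
  simp only [Fintype.card_prod, Nat.cast_mul] at htr
  have hcard : (Fintype.card AI' : ℂ) * Fintype.card AO' *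
      (Fintype.card BI' * Fintype.card BO') ≠ 0 := by simp
  rw [← mul_right_cancel₀ hcard htr]
  ring

theorem nonSignallingAdapters_subset_completelyAdmissibleAdapters :
    nonSignallingAdapters AI AI' AO AO' BI BI' BO BO' ⊆
      completelyAdmissibleAdapters AI AI' AO AO' BI BI' BO BO' := by
  intro U hU
  obtain ⟨hpos, hspan, htr⟩ := mem_nonSignallingAdapters_iff.1 hU
  refine ⟨hpos, ?_⟩
  intro AIbar AObar BIbar BObar _ _ _ _ _ _ _ _ _ _ _ _ M hM
  obtain ⟨hMpos, hMspan, hMtr⟩ := isNonSignallingChannel_iff.1 hM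
  refine isNonSignallingChannel_iff.2 ⟨posSemidef_adapterAction hpos hMpos,
    adapterAction_mem_kroneckerSpan hspan hMspan, ?_⟩
  have hcard : (Fintype.card AI' : ℂ) * Fintype.card AO' *
      (Fintype.card BI' * Fintype.card BO') ≠ 0 := by simp
  refine mul_left_cancel₀ hcard ?_
  rw [trace_adapterAction hspan hMspan, htr, hMtr]
  simp only [Fintype.card_prod, Nat.cast_mul]
  ring

end CompletelyAdmissibleAdapters

end NSAdapter

theorem mainTheorem2 (AI AI' AO AO' BI BI' BO BO' : Type u)
    [Fintype AI] [Fintype AI'] [Fintype AO] [Fintype AO']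
    [Fintype BI] [Fintype BI'] [Fintype BO] [Fintype BO']
    [DecidableEq AI] [DecidableEq AI'] [DecidableEq AO] [DecidableEq AO']
    [DecidableEq BI] [DecidableEq BI'] [DecidableEq BO] [DecidableEq BO']
    [Nonempty AI] [Nonempty AI'] [Nonempty AO] [Nonempty AO']
    [Nonempty BI] [Nonempty BI'] [Nonempty BO] [Nonempty BO'] :
    NSAdapter.completelyAdmissibleAdapters AI AI' AO AO' BI BI' BO BO' =
      NSAdapter.nonSignallingAdapters AI AI' AO AO' BI BI' BO BO' :=
  Set.Subset.antisymm NSAdapter.completelyAdmissibleAdapters_subset_nonSignallingAdapters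
    NSAdapter.nonSignallingAdapters_subset_completelyAdmissibleAdapters
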